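/- An $n$-fold sequence $(r_{m})_{m\in\mathbb N^n}$ of rational numbers is called computable if there are total recursive functions $s,p,q:\mathbb N^n\to\mathbb N$ with $r_m=(-1)^{s(m)}\,\frac{p(m)}{1+q(m)}$ for all $m$. A sequence $(x_n)_{n\in\mathbb N}$ of real numbers is called a computable sequence of computable numbers if there are a computable double sequence $(r_{n,s})$ of rational numbers and a total recursive function $\xi:\mathbb N^2\to\mathbb N$ such that $|x_n-r_{n,s}|<2^{-M}$ for all $n,M,s\in\mathbb N$ with $s\ge\xi(n,M)$; a sequence of complex numbers is computable if the sequences of its real and of its imaginary parts are. For $\sigma\ge 0$ let $\mathcal E_\sigma$ be the set of all entire functions $f$ such that for every $\varepsilon>0$ there is a constant $C(\varepsilon)$ with $|f(z)|\le C(\varepsilon)\,e^{(\sigma+\varepsilon)|z|}$ for all $z\in\mathbb C$, and for $f\in\bigcup_{\sigma\ge0}\mathcal E_\sigma$ let $\mathrm{bw}(f)=\min\{\sigma\ge 0: f\in\mathcal E_\sigma\}$ be the actual bandwidth of $f$. Let $\mathcal{CE}_\pi$ be the set of all $f\in\mathcal E_\pi$ whose coefficients $a_n=f^{(n)}(0)$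 in the Taylor series $f(z)=\sum_{n\ge0}\frac{a_n}{n!}z^n$ form a computable sequence of computable (complex) numbers. Let $\Pi_2$ be the second $\Pi$-class of the Zheng–Weihrauch hierarchy: the set of all real numbers of the form $x=\inf_{i\in\mathbb N}\sup_{j\in\mathbb N} r_{i,j}$ for a computable double sequence $(r_{i,j})$ of rational numbers (all suprema and the infimum being finite). Theorem. 1. If $f\in\mathcal{CE}_\pi$, then $\mathrm{bw}(f)\in\Pi_2$. 2. If $x\in\Pi_2\cap[0,\pi]$, then there exists $f\in\mathcal{CE}_\pi$ with $\mathrm{bw}(f)=x$. Hence $\mathrm{bw}[\mathcal{CE}_\pi]=\Pi_2\cap[0,\pi]$. -/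

import Mathlib

/-- A sequence of rational numbers indexed by `α` (for instance `α = ℕ` or `α = ℕ × ℕ`) is
computable if `r m = (-1) ^ s(m) * p(m) / (1 + q(m))` for total recursive functions `s`, `p`, `q`. -/
def IsComputableRatSeq {α : Type*} [Primcodable α] (r : α → ℚ) : Prop :=
  ∃ s p q : α → ℕ, Computable s ∧ Computable p ∧ Computable q ∧
    ∀ m, r m = (-1 : ℚ) ^ s m * ((p m : ℚ) / (1 + (q m : ℚ)))

/-- A sequence of real numbers indexed by `α` is a computable sequence of computable numbers if it
is the limit of a computable sequence of rational numbers (with one more index), with a recursive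
modulus of convergence `ξ`. -/
def IsComputableRealSeq {α : Type*} [Primcodable α] (x : α → ℝ) : Prop :=
  ∃ (r : α × ℕ → ℚ) (ξ : α × ℕ → ℕ), IsComputableRatSeq r ∧ Computable ξ ∧
    ∀ (m : α) (M s : ℕ), ξ (m, M) ≤ s → |x m - (r (m, s) : ℝ)| < 1 / 2 ^ M

/-- A sequence of complex numbers is computable if its real and imaginary parts are. -/
def IsComputableComplexSeq {α : Type*} [Primcodable α] (a : α → ℂ) : Prop :=
  IsComputableRealSeq (fun m => (a m).re) ∧ IsComputableRealSeq (fun m => (a m).im)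

/-- The class `Π₂` of the Zheng–Weihrauch hierarchy of real numbers: the real numbers
`x = inf_{i} sup_{j} r (i, j)` for a computable double sequence `r` of rational numbers. All
suprema and the infimum are taken in `ℝ`; `S i` is the supremum over `j`. -/
def zhengWeihrauchPi2 : Set ℝ :=
  {x | ∃ r : ℕ × ℕ → ℚ, IsComputableRatSeq r ∧ ∃ S : ℕ → ℝ,
    (∀ i, IsLUB (Set.range fun j => (r (i, j) : ℝ)) (S i)) ∧ IsGLB (Set.range S) x}

/-- The entire functions that are bandlimited with bandwidth `σ`. -/
def bandlimitedFunctions (σ : ℝ) : Set (ℂ → ℂ) :=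
  {f | Differentiable ℂ f ∧
    ∀ ε : ℝ, 0 < ε → ∃ C : ℝ, ∀ z : ℂ, ‖f z‖ ≤ C * Real.exp ((σ + ε) * ‖z‖)}

/-- The actual bandwidth of a bandlimited function: the least `σ ≥ 0` such that `f` is bandlimited
with bandwidth `σ` (see `isLeast_actualBandwidth`). -/
noncomputable def actualBandwidth (f : ℂ → ℂ) : ℝ :=
  sInf {σ : ℝ | 0 ≤ σ ∧ f ∈ bandlimitedFunctions σ}

/-- The infimum in the definition of the actual bandwidth is a minimum. -/
theorem isLeast_actualBandwidth {f : ℂ → ℂ} {σ : ℝ} (hσ : 0 ≤ σ)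
    (hf : f ∈ bandlimitedFunctions σ) :
    IsLeast {τ : ℝ | 0 ≤ τ ∧ f ∈ bandlimitedFunctions τ} (actualBandwidth f) := by
  have hne : {τ : ℝ | 0 ≤ τ ∧ f ∈ bandlimitedFunctions τ}.Nonempty := ⟨σ, hσ, hf⟩
  have hbd : BddBelow {τ : ℝ | 0 ≤ τ ∧ f ∈ bandlimitedFunctions τ} := ⟨0, fun τ h => h.1⟩
  refine ⟨⟨le_csInf hne fun τ h => h.1, hf.1, fun ε hε => ?_⟩, fun τ h => csInf_le hbd h⟩
  obtain ⟨τ, hτ, hlt⟩ := exists_lt_of_csInf_lt hne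
    (show sInf {τ : ℝ | 0 ≤ τ ∧ f ∈ bandlimitedFunctions τ} < actualBandwidth f + ε / 2 by
      unfold actualBandwidth; linarith)
  obtain ⟨C, hC⟩ := hτ.2.2 (ε / 2) (by linarith)
  have hC0 : 0 ≤ C := by simpa using (norm_nonneg _).trans (hC 0)
  refine ⟨C, fun z => (hC z).trans ?_⟩
  have : τ + ε / 2 ≤ actualBandwidth f + ε := by linarith
  gcongr

/-- The computable bandlimited functions of bandwidth `π`: those whose coefficients `f⁽ⁿ⁾(0)` in
the Taylor series `f(z) = ∑ f⁽ⁿ⁾(0) / n! * zⁿ` form a computable sequence of computable numbers. -/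
def computableBandlimitedFunctions : Set (ℂ → ℂ) :=
  {f | f ∈ bandlimitedFunctions Real.pi ∧ IsComputableComplexSeq fun n : ℕ => iteratedDeriv n f 0}

/-! Write `a n` for the Taylor coefficients. Cauchy's estimate and comparison with the exponential
series give bw(f) = limsup |a n|^(1/n) (`isBigO_iteratedDeriv_of_mem_bandlimitedFunctions`,
`mem_bandlimitedFunctions_of_isBigO`), that is, inf over N of sup over n > N. For computable
coefficients, the rationals below |Re a n|^(1/n) or |Im a n|^(1/n) can be enumerated, so each such
supremum is that of a computable row of rationals, and bw(f) lies in Π₂. Conversely, let x = inf S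
i. For each fraction (k+1)/(i+1) certified to be at most S 0, ..., S i, one coefficient is set to
its n-th power, at an index n that also codes the stage of certification. The remaining coefficients
vanish, so all are rational and computable without knowledge of S. Fractions above y > x occur only
finitely often, since some S i₀ < y; fractions in [y, x) occur for all large i, since the grid of
mesh 1/(i+1) becomes fine. Hence the limsup is x. -/

/-! ### Exponential type and growth of Taylor coefficients -/

/-- A weak form of Stirling's upper bound for the factorial. -/
theorem exists_factorial_le_mul_pow :
    ∃ K : ℝ, ∀ n : ℕ, (n.factorial : ℝ) ≤ K * (n + 1) * (n / Real.exp 1) ^ n := by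
  obtain ⟨K, hK⟩ := Stirling.tendsto_stirlingSeq_sqrt_pi.bddAbove_range
  refine ⟨max K 1, fun n => ?_⟩
  rcases Nat.eq_zero_or_pos n with rfl | hn
  · simp
  have hn' : (0 : ℝ) < n := by exact_mod_cast hn
  have hs : Stirling.stirlingSeq n ≤ max K 1 := (hK ⟨n, rfl⟩).trans (le_max_left _ _)
  rw [Stirling.stirlingSeq, div_le_iff₀ (by positivity)] at hs
  have hsq : √(2 * n : ℝ) ≤ n + 1 := Real.sqrt_le_iff.2 ⟨by positivity, by nlinarith⟩
  calc (n.factorial : ℝ) ≤ max K 1 * (√(2 * n : ℝ) * (n / Real.exp 1) ^ n) := hs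
    _ ≤ max K 1 * ((n + 1) * (n / Real.exp 1) ^ n) := by gcongr
    _ = _ := by ring

open Filter Asymptotics in
/-- The Taylor coefficients of a function of exponential type grow at most geometrically. -/
theorem isBigO_iteratedDeriv_of_mem_bandlimitedFunctions {f : ℂ → ℂ} {σ y : ℝ} (hσ : 0 ≤ σ)
    (hf : f ∈ bandlimitedFunctions σ) (hy : σ < y) :
    (fun n : ℕ => iteratedDeriv n f 0) =O[atTop] fun n => y ^ n := by
  obtain ⟨u, hu, huy⟩ := exists_between hy
  have hu0 : 0 < u := hσ.trans_lt hu
  obtain ⟨C, hC⟩ := hf.2 (u - σ) (by linarith)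
  obtain ⟨K, hK⟩ := exists_factorial_le_mul_pow
  have hC0 : 0 ≤ C := by simpa using (norm_nonneg _).trans (hC 0)
  have h1 : (fun n : ℕ => iteratedDeriv n f 0) =O[atTop] fun n : ℕ => ((n : ℝ) + 1) * u ^ n := by
    refine IsBigO.of_bound (K * C) ?_
    filter_upwards [eventually_gt_atTop 0] with n hn
    have hn' : (0 : ℝ) < n := by exact_mod_cast hn
    -- The radius n / u minimises exp(u R) / R ^ n.
    have h := Complex.norm_iteratedDeriv_le_of_forall_mem_sphere_norm_le (c := 0) (R := n / u)
      (C := C * Real.exp n) (f := f) n (by positivity) hf.1.diffContOnCl (fun z hz => by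
        have hz' : ‖z‖ = n / u := by simpa using hz
        refine (hC z).trans_eq ?_
        rw [hz']
        congr 2
        field_simp
        ring)
    refine h.trans ?_
    rw [Real.norm_of_nonneg (by positivity)]
    calc (n.factorial : ℝ) * (C * Real.exp n) / (n / u) ^ n
        ≤ (K * (n + 1) * (n / Real.exp 1) ^ n) * (C * Real.exp n) / (n / u) ^ n := by
          gcongr
          exact hK n
      _ = K * C * ((n + 1) * u ^ n) := by
          rw [← Real.exp_one_pow n, div_pow, div_pow]
          field_simp
  refine h1.trans ?_
  -- The gap between u and y absorbs the polynomial factor left by Stirling.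
  have h2 : (fun n : ℕ => (n : ℝ) + 1) =O[atTop] fun n : ℕ => (y / u) ^ n := by
    have hr : 1 < y / u := (one_lt_div hu0).2 huy
    refine IsBigO.add ?_ ?_
    · exact (isLittleO_coe_const_pow_of_one_lt hr).isBigO
    · refine IsBigO.of_bound 1 (Eventually.of_forall fun n => ?_)
      have := one_le_pow₀ hr.le (n := n)
      rw [Real.norm_of_nonneg (by positivity), Real.norm_of_nonneg (by linarith)]
      simpa using this
  refine (h2.mul (isBigO_refl (fun n : ℕ => u ^ n) atTop)).congr_right fun n => ?_
  rw [← mul_pow, div_mul_cancel₀ _ hu0.ne']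

open Filter Asymptotics in
/-- An entire function whose Taylor coefficients grow at most geometrically has exponential
type. -/
theorem mem_bandlimitedFunctions_of_isBigO {f : ℂ → ℂ} {σ : ℝ} (hσ : 0 ≤ σ)
    (hd : Differentiable ℂ f)
    (hf : ∀ y, σ < y → (fun n : ℕ => iteratedDeriv n f 0) =O[atTop] fun n => y ^ n) :
    f ∈ bandlimitedFunctions σ := by
  refine ⟨hd, fun ε hε => ?_⟩
  have hy : 0 < σ + ε := by linarith
  obtain ⟨C, -, hC⟩ := bound_of_isBigO_nat_atTop (hf (σ + ε) (by linarith))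
  refine ⟨C, fun z => ?_⟩
  have hs := (NormedSpace.expSeries_div_hasSum_exp ((σ + ε) * ‖z‖)).mul_left C
  rw [← Real.exp_eq_exp_ℝ] at hs
  rw [← (Complex.hasSum_taylorSeries_of_entire hd 0 z).tsum_eq]
  refine tsum_of_norm_bounded hs fun n => ?_
  have := hC (pow_ne_zero n hy.ne')
  rw [Real.norm_of_nonneg (by positivity)] at this
  rw [smul_eq_mul, smul_eq_mul, norm_mul, norm_mul, norm_inv, norm_pow, sub_zero,
    Complex.norm_natCast, mul_pow]
  calc ((n.factorial : ℝ))⁻¹ * (‖z‖ ^ n * ‖iteratedDeriv n f 0‖)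
      ≤ ((n.factorial : ℝ))⁻¹ * (‖z‖ ^ n * (C * (σ + ε) ^ n)) := by gcongr
    _ = _ := by ring

open Filter Asymptotics in
/-- Geometrically bounded sequences are sequences of Taylor coefficients of entire functions. -/
theorem exists_differentiable_iteratedDeriv_eq {a : ℕ → ℂ} {y : ℝ} (hy : 0 < y)
    (ha : a =O[atTop] fun n => y ^ n) :
    ∃ f : ℂ → ℂ, Differentiable ℂ f ∧ ∀ n, iteratedDeriv n f 0 = a n := by
  obtain ⟨C, hC0, hC⟩ := bound_of_isBigO_nat_atTop ha
  set p : FormalMultilinearSeries ℂ ℂ ℂ :=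
    FormalMultilinearSeries.ofScalars ℂ fun n => a n / n.factorial with hp
  have hr : p.radius = ⊤ := by
    refine ENNReal.eq_top_of_forall_nnreal_le fun r => ?_
    refine p.le_radius_of_bound (C * Real.exp (y * r)) fun n => ?_
    have h1 := hC (pow_ne_zero n hy.ne')
    rw [Real.norm_of_nonneg (by positivity)] at h1
    have h2 := Real.pow_div_factorial_le_exp (y * r) (by positivity) n
    rw [hp, FormalMultilinearSeries.ofScalars_norm, norm_div, Complex.norm_natCast]
    calc ‖a n‖ / n.factorial * (r : ℝ) ^ n ≤ C * y ^ n / n.factorial * (r : ℝ) ^ n := by gcongr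
      _ = C * ((y * r) ^ n / n.factorial) := by rw [mul_pow]; ring
      _ ≤ _ := by gcongr
  have hps : HasFPowerSeriesOnBall p.sum p 0 ⊤ := by
    have := p.hasFPowerSeriesOnBall (by simp [hr])
    rwa [hr] at this
  refine ⟨p.sum, fun z => (hps.analyticAt_of_mem (by simp)).differentiableAt, fun n => ?_⟩
  have h := hps.factorial_smul 1 n
  rw [iteratedDeriv_eq_iteratedFDeriv, ← h, hp, FormalMultilinearSeries.ofScalars_apply_eq]
  simp only [one_pow, smul_eq_mul, mul_one, nsmul_eq_mul]
  exact mul_div_cancel₀ _ (Nat.cast_ne_zero.2 n.factorial_ne_zero)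

/-! ### Computable arithmetic and comparison of numbers -/

section ComputableArithmetic

variable {α : Type*} [Primcodable α] {f g : α → ℕ}

theorem Computable.natAdd (hf : Computable f) (hg : Computable g) :
    Computable fun a => f a + g a := Primrec.nat_add.to_comp.comp hf hg

theorem Computable.natSub (hf : Computable f) (hg : Computable g) :
    Computable fun a => f a - g a := Primrec.nat_sub.to_comp.comp hf hg

theorem Computable.natMul (hf : Computable f) (hg : Computable g) :
    Computable fun a => f a * g a := Primrec.nat_mul.to_comp.comp hf hg

theorem Computable.natPow (hf : Computable f) (hg : Computable g) :
    Computable fun a => f a ^ g a :=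
  (Primrec₂.unpaired'.1 Nat.Primrec.pow).to_comp.comp hf hg

theorem Computable.decide_natLt (hf : Computable f) (hg : Computable g) :
    Computable fun a => decide (f a < g a) := by
  have h : Computable fun p : ℕ × ℕ => decide (p.1 < p.2) :=
    (PrimrecPred.computablePred Primrec.nat_lt).decide
  exact h.comp (hf.pair hg)

theorem Computable.boolNot {b : α → Bool} (hb : Computable b) : Computable fun a => !b a :=
  Primrec.not.to_comp.comp hb

theorem Computable.boolAnd {b c : α → Bool} (hb : Computable b) (hc : Computable c) :
    Computable fun a => b a && c a := Primrec.and.to_comp.comp hb hc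

theorem Computable.boolOr {b c : α → Bool} (hb : Computable b) (hc : Computable c) :
    Computable fun a => b a || c a := Primrec.or.to_comp.comp hb hc

/-- Bounded existential quantification preserves computability. -/
theorem Computable.exists_exists_lt_iff {p : α × ℕ → Bool} (hp : Computable p) :
    ∃ q : α × ℕ → Bool, Computable q ∧ ∀ a n, q (a, n) = true ↔ ∃ j < n, p (a, j) = true := by
  refine ⟨fun x => Nat.rec (motive := fun _ => Bool) false (fun j b => b || p (x.1, j)) x.2,
    Computable.nat_rec .snd (.const false) (Computable.boolOr (Computable.snd.comp Computable.snd)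
      (hp.comp ((Computable.fst.comp .fst).pair (Computable.fst.comp .snd)))).to₂, fun a n => ?_⟩
  induction n with
  | zero => simp
  | succ n ih =>
    simp only [Bool.or_eq_true] at ih ⊢
    rw [ih]
    grind

/-- Bounded universal quantification preserves computability. -/
theorem Computable.exists_forall_lt_iff {p : α × ℕ → Bool} (hp : Computable p) :
    ∃ q : α × ℕ → Bool, Computable q ∧ ∀ a n, q (a, n) = true ↔ ∀ j < n, p (a, j) = true := by
  obtain ⟨q, hq, h⟩ := Computable.exists_exists_lt_iff hp.boolNot
  refine ⟨fun x => !q x, hq.boolNot, fun a n => ?_⟩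
  rw [Bool.not_eq_true', ← Bool.not_eq_true, h]
  simp

/-- Whether a nonnegative rational number lies strictly below the absolute value of a term of a
computable sequence of real numbers is semidecidable. -/
theorem IsComputableRealSeq.exists_semidecider {x : α → ℝ} (hx : IsComputableRealSeq x)
    {e : α → ℕ} (he : Computable e) :
    ∃ P : α × ℕ × ℕ × ℕ → Bool, Computable P ∧
      ∀ n c d, (∃ M, P (n, c, d, M) = true) ↔ ((c : ℝ) / (1 + d)) ^ e n < |x n| := by
  obtain ⟨r, ξ, ⟨s, p, q, hs, hp, hq, hr⟩, hξ, h⟩ := hx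
  have hn : Computable fun a : α × ℕ × ℕ × ℕ => a.1 := .fst
  have hc : Computable fun a : α × ℕ × ℕ × ℕ => a.2.1 := Computable.fst.comp .snd
  have hd : Computable fun a : α × ℕ × ℕ × ℕ => a.2.2.1 :=
    Computable.fst.comp (Computable.snd.comp .snd)
  have hM : Computable fun a : α × ℕ × ℕ × ℕ => a.2.2.2 :=
    Computable.snd.comp (Computable.snd.comp .snd)
  have hi : Computable fun a : α × ℕ × ℕ × ℕ => (a.1, ξ (a.1, a.2.2.2)) :=
    hn.pair (hξ.comp (hn.pair hM))
  have h2 : Computable fun a : α × ℕ × ℕ × ℕ => 2 ^ a.2.2.2 := (Computable.const 2).natPow hM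
  have hde : Computable fun a : α × ℕ × ℕ × ℕ => (1 + a.2.2.1) ^ e a.1 :=
    ((Computable.const 1).natAdd hd).natPow (he.comp hn)
  -- Stage M accepts if the power plus the error 1 / 2 ^ M is below the M-th rational approximation
  -- in absolute value, with denominators cleared. A true strict inequality is accepted once 2 / 2 ^
  -- M is below the gap.
  refine ⟨_, Computable.decide_natLt
    ((((hc.natPow (he.comp hn)).natMul h2).natAdd hde).natMul
      ((Computable.const 1).natAdd (hq.comp hi)))
    ((hp.comp hi).natMul (hde.natMul h2)), fun n c d => ?_⟩
  have key (M : ℕ) : (c ^ e n * 2 ^ M + (1 + d) ^ e n) * (1 + q (n, ξ (n, M))) <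
      p (n, ξ (n, M)) * ((1 + d) ^ e n * 2 ^ M) ↔
      ((c : ℝ) / (1 + d)) ^ e n + 1 / 2 ^ M < |(r (n, ξ (n, M)) : ℝ)| := by
    have hrabs : |(r (n, ξ (n, M)) : ℝ)| = p (n, ξ (n, M)) / (1 + q (n, ξ (n, M))) := by
      rw [hr]
      push_cast
      rw [abs_mul, abs_pow, abs_neg, abs_one, one_pow, one_mul, abs_of_nonneg (by positivity)]
    rw [hrabs, div_pow, div_add_div _ _ (by positivity) (by positivity),
      div_lt_div_iff₀ (by positivity) (by positivity), mul_one]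
    exact_mod_cast Iff.rfl
  simp only [decide_eq_true_eq, key]
  constructor
  · rintro ⟨M, hM⟩
    have h1 := h n M _ le_rfl
    have h3 := abs_sub_abs_le_abs_sub (r (n, ξ (n, M)) : ℝ) (x n)
    rw [abs_sub_comm] at h3
    linarith
  · intro hlt
    obtain ⟨M, hM⟩ := exists_pow_lt_of_lt_one
      (show 0 < (|x n| - ((c : ℝ) / (1 + d)) ^ e n) / 2 by linarith)
      (show (1 / 2 : ℝ) < 1 by norm_num)
    rw [one_div_pow] at hM
    have h1 := h n M _ le_rfl
    have h3 := abs_sub_abs_le_abs_sub (x n) (r (n, ξ (n, M)) : ℝ)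
    exact ⟨M, by linarith⟩

/-- Comparing the terms of a computable sequence of rational numbers with positive rational numbers
is decidable. -/
theorem IsComputableRatSeq.exists_decider {r : α → ℚ} (hr : IsComputableRatSeq r) :
    ∃ T : α × ℕ × ℕ → Bool, Computable T ∧
      ∀ m k i, T (m, k, i) = true ↔ ((k : ℝ) + 1) / (i + 1) ≤ r m := by
  obtain ⟨s, p, q, hs, hp, hq, hr⟩ := hr
  have hm : Computable fun a : α × ℕ × ℕ => a.1 := .fst
  have hk : Computable fun a : α × ℕ × ℕ => a.2.1 := Computable.fst.comp .snd
  have hi : Computable fun a : α × ℕ × ℕ => a.2.2 := Computable.snd.comp .snd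
  have h1 : Computable fun _ : α × ℕ × ℕ => 1 := .const 1
  -- The threshold is positive, so an odd sign exponent always means rejection.
  refine ⟨_, (Computable.nat_bodd.comp (hs.comp hm)).boolNot.boolAnd
    (Computable.decide_natLt ((hp.comp hm).natMul (hi.natAdd h1))
      ((hk.natAdd h1).natMul (h1.natAdd (hq.comp hm)))).boolNot, fun m k i => ?_⟩
  rw [hr]
  rcases Nat.even_or_odd (s m) with h | h
  · have hb : (s m).bodd = false := by
      obtain ⟨t, ht⟩ := h
      rw [ht, Nat.bodd_add, Bool.xor_self]
    push_cast
    rw [h.neg_one_pow, one_mul, div_le_div_iff₀ (by positivity) (by positivity)]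
    simp only [hb, Bool.not_false, Bool.true_and, Bool.not_eq_true', decide_eq_false_iff_not,
      not_lt]
    exact_mod_cast Iff.rfl
  · have hb : (s m).bodd = true := by
      obtain ⟨t, ht⟩ := h
      simp [ht, Nat.bodd_two]
    push_cast
    have h2 : (0 : ℝ) < (k + 1) / (i + 1) := by positivity
    have h3 : (0 : ℝ) ≤ p m / (1 + q m) := by positivity
    rw [h.neg_one_pow]
    simp only [hb, Bool.not_true, Bool.false_and, Bool.false_eq_true, false_iff]
    linarith

end ComputableArithmetic

/-! ### The bandwidth of a computable function lies in Π₂ -/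

open Filter Asymptotics in
/-- If the Taylor coefficients are eventually bounded by a geometric sequence, then its ratio
bounds the bandwidth. -/
theorem actualBandwidth_le_of_abs_le {f : ℂ → ℂ} (hd : Differentiable ℂ f) {S : ℝ} (hS : 0 ≤ S)
    {N : ℕ} (hre : ∀ n, N < n → |(iteratedDeriv n f 0).re| ≤ S ^ n)
    (him : ∀ n, N < n → |(iteratedDeriv n f 0).im| ≤ S ^ n) : actualBandwidth f ≤ S := by
  have hm : f ∈ bandlimitedFunctions S := by
    refine mem_bandlimitedFunctions_of_isBigO hS hd fun y hy => IsBigO.of_bound 2 ?_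
    filter_upwards [eventually_gt_atTop N] with n hn
    have h1 := Complex.norm_le_abs_re_add_abs_im (iteratedDeriv n f 0)
    have h2 := hre n hn
    have h3 := him n hn
    have h4 : S ^ n ≤ y ^ n := by gcongr
    rw [Real.norm_of_nonneg (pow_nonneg (hS.trans hy.le) n)]
    linarith
  exact (isLeast_actualBandwidth hS hm).2 ⟨hS, hm⟩

theorem exists_natCast_div_between {v w : ℝ} (hv : 0 ≤ v) (hvw : v < w) :
    ∃ c d : ℕ, v < (c : ℝ) / (1 + d) ∧ (c : ℝ) / (1 + d) < w := by
  obtain ⟨q, hq1, hq2⟩ := exists_rat_btwn hvw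
  have hq0 : 0 < q := by exact_mod_cast hv.trans_lt hq1
  have h : ((q.num.toNat : ℕ) : ℝ) / (1 + ((q.den - 1 : ℕ) : ℝ)) = q := by
    have h1 : ((q.num.toNat : ℕ) : ℝ) = (q.num : ℝ) := by
      have := Int.toNat_of_nonneg (Rat.num_pos.2 hq0).le
      exact_mod_cast congrArg (Int.cast (R := ℝ)) this
    have h2 : (1 + ((q.den - 1 : ℕ) : ℝ)) = q.den := by
      rw [Nat.cast_sub q.den_pos]
      simp
    rw [h1, h2]
    exact_mod_cast Rat.num_div_den q
  exact ⟨q.num.toNat, q.den - 1, by rwa [h], by rwa [h]⟩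

/-- Right continuity of the power at v leaves room for a rational, so no n-th roots are needed. -/
theorem exists_natCast_div_pow_lt {v w : ℝ} (hv : 0 ≤ v) {n : ℕ} (h : v ^ n < w) :
    ∃ c d : ℕ, v < (c : ℝ) / (1 + d) ∧ ((c : ℝ) / (1 + d)) ^ n < w := by
  have h1 : ∀ᶠ u in nhdsWithin v (Set.Ioi v), u ^ n < w :=
    ((continuous_pow n).tendsto v |>.mono_left nhdsWithin_le_nhds).eventually_lt_const h
  obtain ⟨u, hu, hvu⟩ := (h1.and self_mem_nhdsWithin).exists
  obtain ⟨c, d, hc, hd⟩ := exists_natCast_div_between hv hvu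
  exact ⟨c, d, hc, (pow_le_pow_left₀ (by positivity) hd.le n).trans_lt hu⟩

open Filter Asymptotics in
/-- The actual bandwidth of a computable bandlimited function belongs to `Π₂`. -/
theorem actualBandwidth_mem_zhengWeihrauchPi2 {f : ℂ → ℂ} {σ : ℝ} (hσ : 0 ≤ σ)
    (hf : f ∈ bandlimitedFunctions σ)
    (hc : IsComputableComplexSeq fun n : ℕ => iteratedDeriv n f 0) :
    actualBandwidth f ∈ zhengWeihrauchPi2 := by
  set b := actualBandwidth f with hb
  obtain ⟨⟨hb0, hfb⟩, -⟩ := isLeast_actualBandwidth hσ hf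
  rw [← hb] at hb0 hfb
  obtain ⟨P, hP, hPx⟩ := hc.1.exists_semidecider Computable.id
  obtain ⟨Q, hQ, hQx⟩ := hc.2.exists_semidecider Computable.id
  -- The column index codes (offset, c, d, M); the coefficient index N + offset + 1 runs through all
  -- n > N. Index 0 never occurs: a zeroth power would let every fraction pass as soon as |a 0| > 1.
  let t : ℕ × ℕ → ℕ × ℕ × ℕ × ℕ := fun m => Denumerable.ofNat _ m.2
  let u : ℕ × ℕ → ℕ × ℕ × ℕ × ℕ := fun m => (m.1 + (t m).1 + 1, (t m).2)
  let B : ℕ × ℕ → Bool := fun m => P (u m) || Q (u m)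
  have ht : Computable t := (Computable.ofNat _).comp .snd
  have hu : Computable u := ((Computable.fst.natAdd (Computable.fst.comp ht)).natAdd
    (.const 1)).pair (Computable.snd.comp ht)
  have hB : Computable B := (hP.comp hu).boolOr (hQ.comp hu)
  let r : ℕ × ℕ → ℚ := fun m => if B m then ((t m).2.1 : ℚ) / (1 + (t m).2.2.1) else 0
  have hr : IsComputableRatSeq r := by
    refine ⟨fun _ => 0, _, fun m => (t m).2.2.1, .const 0,
      Computable.cond hB (Computable.fst.comp (Computable.snd.comp ht)) (.const 0),
      Computable.fst.comp (Computable.snd.comp (Computable.snd.comp ht)), fun m => ?_⟩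
    simp only [r]
    cases B m <;> simp
  have hr0 (m : ℕ × ℕ) : 0 ≤ (r m : ℝ) := by
    simp only [r]
    split_ifs
    · push_cast
      positivity
    · simp
  -- every value is `0` or is witnessed by a large Taylor coefficient
  have hrle {N : ℕ} {w : ℝ} (hw0 : 0 ≤ w)
      (hw : ∀ n v, N < n → 0 ≤ v → v ^ n < ‖iteratedDeriv n f 0‖ → v ≤ w) (j : ℕ) :
      (r (N, j) : ℝ) ≤ w := by
    simp only [r]
    split_ifs with h
    · push_cast
      refine hw (u (N, j)).1 _ (by simp only [u]; omega) (by positivity) ?_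
      rcases (Bool.or_eq_true_iff (x := P (u (N, j)))).1 h with h | h
      · exact ((hPx _ _ _).1 ⟨_, h⟩).trans_le (Complex.abs_re_le_norm _)
      · exact ((hQx _ _ _).1 ⟨_, h⟩).trans_le (Complex.abs_im_le_norm _)
    · simpa using hw0
  have hge {N n c d : ℕ} (hn : N < n)
      (h : (∃ M, P (n, c, d, M) = true) ∨ ∃ M, Q (n, c, d, M) = true) :
      ∃ j, (r (N, j) : ℝ) = (c : ℝ) / (1 + d) := by
    have h' : ∃ M, (P (n, c, d, M) || Q (n, c, d, M)) = true := by
      rcases h with ⟨M, h⟩ | ⟨M, h⟩ <;> exact ⟨M, by simp [h]⟩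
    obtain ⟨M, h⟩ := h'
    refine ⟨Encodable.encode (n - N - 1, c, d, M), ?_⟩
    have htj : t (N, Encodable.encode (n - N - 1, c, d, M)) = (n - N - 1, c, d, M) :=
      Denumerable.ofNat_encode _
    have hn' : N + (n - N - 1) + 1 = n := by omega
    simp only [r, B, u, htj, hn', h, if_true]
    push_cast
    rfl
  have hbdd (N : ℕ) : BddAbove (Set.range fun j => (r (N, j) : ℝ)) := by
    obtain ⟨C, -, hC⟩ := bound_of_isBigO_nat_atTop
      (isBigO_iteratedDeriv_of_mem_bandlimitedFunctions hb0 hfb (lt_add_one b))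
    -- For n ≥ 1, C ≤ (max C 1) ^ n, so the constant can be moved inside the power.
    refine ⟨max C 1 * (b + 1), ?_⟩
    rintro _ ⟨j, rfl⟩
    refine hrle (by positivity) (fun n v hn hv h => ?_) j
    have h1 := hC (pow_ne_zero n (by positivity : b + 1 ≠ 0))
    rw [Real.norm_of_nonneg (by positivity)] at h1
    refine (lt_of_pow_lt_pow_left₀ n (by positivity) (h.trans_le (h1.trans ?_))).le
    rw [mul_pow]
    gcongr
    exact (le_max_left _ _).trans (le_self_pow₀ (le_max_right _ _) (by omega))
  have hlub (N : ℕ) := isLUB_csSup (Set.range_nonempty fun j => (r (N, j) : ℝ)) (hbdd N)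
  refine ⟨r, hr, fun N => sSup (Set.range fun j => (r (N, j) : ℝ)), hlub, ?_, ?_⟩
  · rintro _ ⟨N, rfl⟩
    have hS0 : 0 ≤ sSup (Set.range fun j => (r (N, j) : ℝ)) :=
      (hr0 (N, 0)).trans ((hlub N).1 ⟨0, rfl⟩)
    have hle {n c d : ℕ} (hn : N < n)
        (h : (∃ M, P (n, c, d, M) = true) ∨ ∃ M, Q (n, c, d, M) = true) :
        (c : ℝ) / (1 + d) ≤ sSup (Set.range fun j => (r (N, j) : ℝ)) := by
      obtain ⟨j, hj⟩ := hge hn h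
      exact hj ▸ (hlub N).1 ⟨j, rfl⟩
    refine actualBandwidth_le_of_abs_le hf.1 hS0 (N := N) (fun n hn => ?_) fun n hn => ?_
    · by_contra! h
      obtain ⟨c, d, h1, h2⟩ := exists_natCast_div_pow_lt hS0 h
      exact h1.not_ge (hle hn (Or.inl ((hPx n c d).2 h2)))
    · by_contra! h
      obtain ⟨c, d, h1, h2⟩ := exists_natCast_div_pow_lt hS0 h
      exact h1.not_ge (hle hn (Or.inr ((hQx n c d).2 h2)))
  · intro L hL
    refine le_of_forall_gt_imp_ge_of_dense fun y hy => ?_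
    obtain ⟨y', hy', hyy⟩ := exists_between hy
    -- The intermediate ratio y' removes the constant: eventually the coefficients are bounded by y
    -- ^ n itself, so some row is bounded by y.
    have h1 := (isBigO_iteratedDeriv_of_mem_bandlimitedFunctions hb0 hfb hy').trans_isLittleO
      (isLittleO_pow_pow_of_lt_left (hb0.trans hy'.le) hyy)
    obtain ⟨N, hN⟩ := eventually_atTop.1 (h1.def one_pos)
    refine (hL ⟨N, rfl⟩).trans (csSup_le (Set.range_nonempty _) ?_)
    rintro _ ⟨j, rfl⟩
    have hy0 : 0 ≤ y := hb0.trans hy.le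
    refine hrle hy0 (fun n v hn hv h => ?_) j
    have h2 := hN n hn.le
    rw [one_mul, Real.norm_of_nonneg (by positivity)] at h2
    exact (lt_of_pow_lt_pow_left₀ n hy0 (h.trans_le h2)).le

/-! ### Realising every number of Π₂ ∩ [0, π] -/

/-- For a computable double sequence `r` of rational numbers with row suprema `S i`, the triples
`(i, k, j)` such that `j` is the least stage at which `(k + 1) / (i + 1)` is seen to be at most
each of `S 0, …, S i` form a decidable set. -/
theorem IsComputableRatSeq.exists_first_stage {r : ℕ × ℕ → ℚ} (hr : IsComputableRatSeq r)
    {S : ℕ → ℝ} (hS : ∀ i, IsLUB (Set.range fun j => (r (i, j) : ℝ)) (S i)) :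
    ∃ E : ℕ × ℕ × ℕ → Bool, Computable E ∧
      (∀ i k j : ℕ, E (i, k, j) = true → ∀ i' ≤ i, ((k : ℝ) + 1) / (i + 1) ≤ S i') ∧
      (∀ i k : ℕ, (∀ i' ≤ i, ((k : ℝ) + 1) / (i + 1) < S i') → ∃ j, E (i, k, j) = true) ∧
      ∀ i k j j', E (i, k, j) = true → E (i, k, j') = true → j = j' := by
  obtain ⟨T, hT, hTr⟩ := hr.exists_decider
  obtain ⟨q, hq, hqT⟩ := Computable.exists_exists_lt_iff
    (p := fun a : (ℕ × ℕ × ℕ) × ℕ => T ((a.1.2.2, a.2), a.1.2.1, a.1.1))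
    (hT.comp (((Computable.snd.comp (Computable.snd.comp .fst)).pair .snd).pair
      ((Computable.fst.comp (Computable.snd.comp .fst)).pair (Computable.fst.comp .fst))))
  obtain ⟨U, hU, hUq⟩ := Computable.exists_forall_lt_iff
    (p := fun a : (ℕ × ℕ × ℕ) × ℕ => q ((a.1.1, a.1.2.1, a.2), a.1.2.2))
    (hq.comp (((Computable.fst.comp .fst).pair
      ((Computable.fst.comp (Computable.snd.comp .fst)).pair .snd)).pair
      (Computable.snd.comp (Computable.snd.comp .fst))))
  have hseen (i k j : ℕ) : U ((i, k, j), i + 1) = true ↔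
      ∀ i' < i + 1, ∃ j' < j, ((k : ℝ) + 1) / (i + 1) ≤ r (i', j') := by
    simp only [hUq, hqT, hTr]
  have hmono {i k j j' : ℕ} (hj : j ≤ j') (h : U ((i, k, j), i + 1) = true) :
      U ((i, k, j'), i + 1) = true := by
    rw [hseen] at h ⊢
    intro i' hi'
    obtain ⟨l, hl, h⟩ := h i' hi'
    exact ⟨l, hl.trans_le hj, h⟩
  have hi : Computable fun a : ℕ × ℕ × ℕ => a.1 := .fst
  have hk : Computable fun a : ℕ × ℕ × ℕ => a.2.1 := Computable.fst.comp .snd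
  have hj : Computable fun a : ℕ × ℕ × ℕ => a.2.2 := Computable.snd.comp .snd
  have hi1 := hi.natAdd (.const 1)
  -- `U` is monotone in the stage and false at stage 0, so it switches to true at most once; `E`
  -- marks the last stage before the switch.
  refine ⟨fun a => U ((a.1, a.2.1, a.2.2 + 1), a.1 + 1) && !U ((a.1, a.2.1, a.2.2), a.1 + 1),
    (hU.comp ((hi.pair (hk.pair (hj.natAdd (.const 1)))).pair hi1)).boolAnd
      (hU.comp ((hi.pair (hk.pair hj)).pair hi1)).boolNot,
    fun i k j h i' hi' => ?_, fun i k h => ?_, fun i k j j' h h' => ?_⟩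
  · rw [Bool.and_eq_true, hseen] at h
    obtain ⟨j', -, hj'⟩ := h.1 i' (Nat.lt_succ_of_le hi')
    exact hj'.trans ((hS i').1 ⟨j', rfl⟩)
  · have hex : ∃ j, U ((i, k, j), i + 1) = true := by
      have h1 (i' : ℕ) : ∃ j', i' ≤ i → ((k : ℝ) + 1) / (i + 1) ≤ r (i', j') := by
        by_cases hi' : i' ≤ i
        · obtain ⟨_, ⟨j', rfl⟩, hj', -⟩ := (hS i').exists_between (h i' hi')
          exact ⟨j', fun _ => hj'.le⟩
        · exact ⟨0, fun h => absurd h hi'⟩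
      choose g hg using h1
      refine ⟨(Finset.range (i + 1)).sup g + 1, (hseen _ _ _).2 fun i' hi' => ⟨g i', ?_, ?_⟩⟩
      · exact Nat.lt_succ_of_le (Finset.le_sup (Finset.mem_range.2 hi'))
      · exact hg i' (Nat.le_of_lt_succ hi')
    classical
    have hpos : Nat.find hex ≠ 0 := by
      intro h0
      have := Nat.find_spec hex
      rw [h0, hseen] at this
      obtain ⟨l, hl, -⟩ := this 0 (Nat.succ_pos i)
      exact absurd hl (Nat.not_lt_zero l)
    obtain ⟨j, hj⟩ := Nat.exists_eq_succ_of_ne_zero hpos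
    refine ⟨j, ?_⟩
    have h1 := Nat.find_spec hex
    have h2 := Nat.find_min hex (m := j) (by omega)
    rw [hj] at h1
    rw [Bool.and_eq_true, Bool.not_eq_true']
    exact ⟨h1, by simpa using h2⟩
  · simp only [Bool.and_eq_true, Bool.not_eq_true'] at h h'
    rcases lt_trichotomy j j' with hlt | heq | hlt
    · have := hmono hlt h.1
      simp [this] at h'
    · exact heq
    · have := hmono hlt h'.1
      simp [this] at h

open Filter Asymptotics in
/-- Every element of `Π₂ ∩ [0, π]` is the actual bandwidth of a computable bandlimited function. -/
theorem exists_actualBandwidth_eq {x : ℝ} (hx : x ∈ zhengWeihrauchPi2) (hx0 : 0 ≤ x)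
    (hxpi : x ≤ Real.pi) : ∃ f ∈ computableBandlimitedFunctions, actualBandwidth f = x := by
  obtain ⟨r, hr, S, hS, hSx⟩ := hx
  obtain ⟨E, hE, hle, hex, huniq⟩ := hr.exists_first_stage hS
  let t : ℕ → ℕ × ℕ × ℕ := fun n => Denumerable.ofNat _ n
  have ht : Computable t := Computable.ofNat _
  -- Each pair (i, k) contributes at most one nonzero coefficient, since its j is unique.
  let a : ℕ → ℝ := fun n => if E (t n) then (((t n).2.1 + 1 : ℝ) / ((t n).1 + 1)) ^ n else 0
  have ha0 (n : ℕ) : 0 ≤ a n := by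
    simp only [a]
    split_ifs <;> positivity
  -- only finitely many coefficients exceed the geometric sequence of a ratio `y > x`
  have hfin {y : ℝ} (hy : x < y) : ∀ᶠ n in atTop, a n ≤ y ^ n := by
    have hy0 : 0 < y := hx0.trans_lt hy
    obtain ⟨_, ⟨i₀, rfl⟩, hi₀⟩ := (isGLB_lt_iff hSx).1 hy
    -- For i ≥ i₀ the fraction is at most S i₀ < y; for i < i₀ the bound S 0 limits k.
    have hF : {m : ℕ × ℕ × ℕ | E m = true ∧ y < ((m.2.1 : ℝ) + 1) / (m.1 + 1)}.Finite := by
      have h1 : ∀ m ∈ {m : ℕ × ℕ × ℕ | E m = true ∧ y < ((m.2.1 : ℝ) + 1) / (m.1 + 1)},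
          (m.1, m.2.1) ∈ Set.Iio i₀ ×ˢ Set.Iic ⌈S 0 * i₀⌉₊ := by
        rintro ⟨i, k, j⟩ ⟨h, hlt⟩
        have hi : i < i₀ := by
          by_contra! hi
          exact (hlt.trans_le (hle i k j h i₀ hi)).not_gt hi₀
        refine ⟨hi, ?_⟩
        have h0 := hle i k j h 0 (Nat.zero_le i)
        have hS0 : 0 ≤ S 0 := le_trans (by positivity) h0
        rw [div_le_iff₀ (by positivity)] at h0
        have h3 : (i : ℝ) + 1 ≤ i₀ := by exact_mod_cast hi
        have h4 : S 0 * (i + 1) ≤ S 0 * i₀ := by gcongr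
        have h5 : (k : ℝ) ≤ ⌈S 0 * i₀⌉₊ := by linarith [Nat.le_ceil (S 0 * (i₀ : ℝ))]
        exact_mod_cast h5
      refine Set.Finite.of_finite_image (f := fun m : ℕ × ℕ × ℕ => (m.1, m.2.1)) ?_ ?_
      · exact ((Set.finite_Iio i₀).prod (Set.finite_Iic _)).subset (Set.image_subset_iff.2 h1)
      · rintro ⟨i, k, j⟩ ⟨h, -⟩ ⟨i', k', j'⟩ ⟨h', -⟩ heq
        obtain ⟨rfl, rfl⟩ := Prod.mk.inj heq
        rw [huniq _ _ _ _ h h']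
    have hF' := hF.preimage (f := t) (Denumerable.eqv (ℕ × ℕ × ℕ)).symm.injective.injOn
    rw [← Nat.cofinite_eq_atTop]
    filter_upwards [hF'.compl_mem_cofinite] with n hn
    simp only [a]
    split_ifs with h
    · gcongr
      by_contra! hlt
      exact hn ⟨h, hlt⟩
    · positivity
  -- infinitely many coefficients exceed the geometric sequence of a ratio `y < x`
  have hinf {y : ℝ} (hy0 : 0 < y) (hy : y < x) (N : ℕ) : ∃ n ≥ N, y ^ n ≤ a n := by
    -- With k + 1 = ⌈y (i + 1)⌉ the fraction lies in [y, y + 1/(i + 1)), hence below x for such i.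
    have h1 : ∀ i : ℕ, 1 / (x - y) ≤ i → ∃ m : ℕ × ℕ × ℕ, m.1 = i ∧ E m = true ∧
        y ≤ ((m.2.1 : ℝ) + 1) / (m.1 + 1) := by
      intro i hi
      have hpos : 0 < y * ((i : ℝ) + 1) := by positivity
      obtain ⟨k, hk⟩ := Nat.exists_eq_succ_of_ne_zero (Nat.ceil_pos.2 hpos).ne'
      have hk' : ((k : ℝ) + 1) = (⌈y * ((i : ℝ) + 1)⌉₊ : ℝ) := by rw [hk]; push_cast; rfl
      have h2 := Nat.le_ceil (y * ((i : ℝ) + 1))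
      have h3 := Nat.ceil_lt_add_one hpos.le
      rw [div_le_iff₀ (by linarith)] at hi
      obtain ⟨j, hj⟩ := hex i k fun i' _ => by
        refine lt_of_lt_of_le ?_ (hSx.1 ⟨i', rfl⟩)
        rw [div_lt_iff₀ (by positivity), hk']
        nlinarith
      refine ⟨(i, k, j), rfl, hj, ?_⟩
      rw [le_div_iff₀ (by positivity)]
      linarith
    obtain ⟨I, hI⟩ := exists_nat_ge (1 / (x - y))
    choose! m hm1 hm2 hm3 using h1
    have hinj : Function.Injective fun i : ℕ => Encodable.encode (m (I + i)) := by
      intro i i' h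
      have h2 := congrArg Prod.fst (Encodable.encode_injective h)
      have hI' (l : ℕ) : 1 / (x - y) ≤ ((I + l : ℕ) : ℝ) := by
        push_cast
        linarith [l.cast_nonneg (α := ℝ)]
      rw [hm1 _ (hI' i), hm1 _ (hI' i')] at h2
      omega
    obtain ⟨i, hi⟩ := (hinj.nat_tendsto_atTop.eventually_ge_atTop N).exists
    have hIi : 1 / (x - y) ≤ ((I + i : ℕ) : ℝ) := by
      push_cast
      linarith [i.cast_nonneg (α := ℝ)]
    refine ⟨_, hi, ?_⟩
    have htm : t (Encodable.encode (m (I + i))) = m (I + i) := Denumerable.ofNat_encode _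
    simp only [a, htm, hm2 _ hIi, if_true]
    gcongr
    exact hm3 _ hIi
  have hO {y : ℝ} (hy : x < y) : (fun n => (a n : ℂ)) =O[atTop] fun n => y ^ n := by
    refine IsBigO.of_bound 1 ?_
    filter_upwards [hfin hy] with n hn
    rw [Complex.norm_of_nonneg (ha0 n), one_mul,
      Real.norm_of_nonneg (pow_nonneg (hx0.trans hy.le) n)]
    exact hn
  obtain ⟨f, hfd, hfa⟩ :=
    exists_differentiable_iteratedDeriv_eq (by linarith : 0 < x + 1) (hO (lt_add_one x))
  have hfx {σ : ℝ} (hσ : x ≤ σ) : f ∈ bandlimitedFunctions σ :=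
    mem_bandlimitedFunctions_of_isBigO (hx0.trans hσ) hfd fun y hy => by
      simpa only [hfa] using hO (hσ.trans_lt hy)
  have hcomp : IsComputableRealSeq a := by
    let p : ℕ × ℕ → ℕ := fun m => bif E (t m.1) then ((t m.1).2.1 + 1) ^ m.1 else 0
    let q : ℕ × ℕ → ℕ := fun m => ((t m.1).1 + 1) ^ m.1 - 1
    have htm : Computable fun m : ℕ × ℕ => t m.1 := ht.comp .fst
    have hp : Computable p := Computable.cond (hE.comp htm)
      (((Computable.fst.comp (Computable.snd.comp htm)).natAdd (.const 1)).natPow .fst) (.const 0)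
    have hq : Computable q :=
      (((Computable.fst.comp htm).natAdd (.const 1)).natPow .fst).natSub (.const 1)
    refine ⟨fun m => (-1 : ℚ) ^ 0 * ((p m : ℚ) / (1 + (q m : ℚ))), fun _ => 0,
      ⟨fun _ => 0, p, q, .const 0, hp, hq, fun _ => rfl⟩, .const 0, fun n M s _ => ?_⟩
    have hq1 : (1 + (q (n, s) : ℝ)) = ((t n).1 + 1 : ℝ) ^ n := by
      simp only [q]
      rw [Nat.cast_sub (Nat.one_le_pow _ _ (Nat.succ_pos _))]
      push_cast
      ring
    have heq : a n = (((-1 : ℚ) ^ 0 * ((p (n, s) : ℚ) / (1 + (q (n, s) : ℚ))) : ℚ) : ℝ) := by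
      push_cast
      rw [hq1]
      simp only [a, p]
      cases E (t n) <;> simp [div_pow]
    rw [heq, sub_self, abs_zero]
    positivity
  have hzero : IsComputableRealSeq fun _ : ℕ => (0 : ℝ) :=
    ⟨fun _ => 0, fun _ => 0, ⟨fun _ => 0, fun _ => 0, fun _ => 0, .const 0, .const 0, .const 0,
      fun _ => by simp⟩, .const 0, fun _ M _ _ => by simp⟩
  have hleast := isLeast_actualBandwidth hx0 (hfx le_rfl)
  refine ⟨f, ⟨hfx hxpi, ?_, ?_⟩, le_antisymm (hleast.2 ⟨hx0, hfx le_rfl⟩) ?_⟩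
  · simpa only [hfa, Complex.ofReal_re] using hcomp
  · simpa only [hfa, Complex.ofReal_im] using hzero
  · by_contra! hlt
    obtain ⟨y', hy', hyx⟩ := exists_between hlt
    obtain ⟨y, hy, hyx⟩ := exists_between hyx
    have hy'0 : 0 < y' := hleast.1.1.trans_lt hy'
    have h1 := (isBigO_iteratedDeriv_of_mem_bandlimitedFunctions hleast.1.1 hleast.1.2
      hy').trans_isLittleO (isLittleO_pow_pow_of_lt_left hy'0.le hy)
    -- The factor 1/2 contradicts the coefficients that are at least y ^ n.
    obtain ⟨N, hN⟩ := eventually_atTop.1 (h1.def (show (0 : ℝ) < 1 / 2 by norm_num))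
    have hy0 := hy'0.trans hy
    obtain ⟨n, hn, hyn⟩ := hinf hy0 hyx N
    have h2 := hN n hn
    rw [hfa, Complex.norm_of_nonneg (ha0 n), Real.norm_of_nonneg (by positivity)] at h2
    linarith [pow_pos hy0 n]

theorem mainTheorem1 :
    (∀ f ∈ computableBandlimitedFunctions, actualBandwidth f ∈ zhengWeihrauchPi2) ∧
    (∀ x ∈ zhengWeihrauchPi2 ∩ Set.Icc 0 Real.pi,
      ∃ f ∈ computableBandlimitedFunctions, actualBandwidth f = x) ∧
    actualBandwidth '' computableBandlimitedFunctions =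
      zhengWeihrauchPi2 ∩ Set.Icc 0 Real.pi := by
  have h1 : ∀ f ∈ computableBandlimitedFunctions, actualBandwidth f ∈ zhengWeihrauchPi2 :=
    fun f hf => actualBandwidth_mem_zhengWeihrauchPi2 Real.pi_nonneg hf.1 hf.2
  have h2 : ∀ x ∈ zhengWeihrauchPi2 ∩ Set.Icc 0 Real.pi,
      ∃ f ∈ computableBandlimitedFunctions, actualBandwidth f = x :=
    fun x hx => exists_actualBandwidth_eq hx.1 hx.2.1 hx.2.2
  refine ⟨h1, h2, Set.Subset.antisymm ?_ h2⟩
  rintro _ ⟨f, hf, rfl⟩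
  have hl := isLeast_actualBandwidth Real.pi_nonneg hf.1
  exact ⟨h1 f hf, hl.1.1, hl.2 ⟨Real.pi_nonneg, hf.1⟩⟩
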